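/- Let $\mathbb{F}$ be an algebraically closed field of characteristic $0$ and let $\overline{x}=(x_1,\dots,x_n)$. An algebraic circuit is a directed acyclic graph whose leaves are labelled by variables $x_i$ or constants of $\mathbb{F}$ and whose other nodes are addition and multiplication gates of arbitrary fan-in; its size is the number of its nodes plus the number of its edges. There is a polynomial function $p$ with coefficients in $\mathbb{N}$, independent of $\mathbb{F}$ and $n$, such that the following holds. If a nonzero $f\in\mathbb{F}[\overline{x}]$ is computed by a circuit of size at most $s$, and $h\in\mathbb{F}[\overline{x}]$ is a factor of $f$ of total degree $d$, then there are polynomials $A,B\in\mathbb{F}[\overline{x}]$, each computed by a circuit of size at most $p(sd)$, such that $$h = A/B \bmod \langle\overline{x}\rangle^{d+1},$$ that is: $B\neq 0$, the quotient $A/B$ lies in the power series ring $\mathbb{F}[[\overline{x}]]$, and it is congruent to $h$ modulo the ideal $\langle\overline{x}\rangle^{d+1}$ of $\mathbb{F}[[\overline{x}]]$. (Here $B$ is not required to be invertible in $\mathbb{F}[[\overline{x}]]$, nor to have low degree.) -/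

import Mathlib

open MvPolynomial

universe u

/-- A node of an algebraic circuit over `F` in the variables `x_0, …, x_{n-1}`, placed after `k`
earlier nodes: a leaf (an input variable or a field constant), or an addition or multiplication
gate of arbitrary fan-in. The list of a gate holds its incoming edges, given by the nodes at which
they start; parallel edges are allowed (so `[i, i]` under `mul` squares node `i`). -/
inductive AlgGate (F : Type u) (n k : ℕ) : Type u
  | var (i : Fin n) : AlgGate F n k
  | const (c : F) : AlgGate F n k
  | add (inputs : List (Fin k)) : AlgGate F n k
  | mul (inputs : List (Fin k)) : AlgGate F n k

namespace AlgGate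

variable {F : Type u} {n k : ℕ}

/-- The number of edges that enter the node. -/
def fanIn : AlgGate F n k → ℕ
  | var _ => 0
  | const _ => 0
  | add l => l.length
  | mul l => l.length

/-- The polynomial computed at the node when `v` lists those computed at the earlier nodes. -/
noncomputable def eval [Field F] (v : Fin k → MvPolynomial (Fin n) F) :
    AlgGate F n k → MvPolynomial (Fin n) F
  | var i => X i
  | const c => C c
  | add l => (l.map v).sum
  | mul l => (l.map v).prod

end AlgGate

/-- An algebraic circuit with `k` nodes: a directed acyclic graph whose nodes are listed in a
topological order, every edge going from an earlier node to a later one. Any node may have any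
number of outgoing edges. -/
inductive AlgCircuit (F : Type u) (n : ℕ) : ℕ → Type u
  | nil : AlgCircuit F n 0
  | snoc {k : ℕ} (c : AlgCircuit F n k) (g : AlgGate F n k) : AlgCircuit F n (k + 1)

namespace AlgCircuit

variable {F : Type u} {n : ℕ}

/-- The size of a circuit: its number of nodes plus its number of edges. -/
def size {k : ℕ} : AlgCircuit F n k → ℕ
  | nil => 0
  | snoc c g => c.size + 1 + g.fanIn

/-- The polynomials computed at the nodes of a circuit. -/
noncomputable def value [Field F] {k : ℕ} : AlgCircuit F n k → Fin k → MvPolynomial (Fin n) F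
  | nil => Fin.elim0
  | snoc c g => Fin.snoc (α := fun _ => MvPolynomial (Fin n) F) c.value (g.eval c.value)

end AlgCircuit

/-- `f` is computed, at a chosen root node, by an algebraic circuit of size at most `s`. -/
def HasCircuitOfSize {F : Type u} [Field F] {n : ℕ} (s : ℕ) (f : MvPolynomial (Fin n) F) : Prop :=
  ∃ (k : ℕ) (c : AlgCircuit F n k) (root : Fin k), c.value root = f ∧ c.size ≤ s

/-- The ideal `⟨x_0, …, x_{n-1}⟩` of the ring of formal power series. -/
noncomputable def varIdeal (F : Type u) [Field F] (n : ℕ) : Ideal (MvPowerSeries (Fin n) F) :=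
  Ideal.span (Set.range fun i : Fin n => (MvPowerSeries.X i : MvPowerSeries (Fin n) F))

/-- `h = A / B mod ⟨x_0, …, x_{n-1}⟩ ^ e`: the denominator is nonzero, the quotient `q = A / B`
exists in the ring of formal power series (a domain, so `q` is unique), and `q` is congruent to `h`.
It is not required that `B` be invertible as a power series. -/
def IsQuotientMod {F : Type u} [Field F] {n : ℕ} (h A B : MvPolynomial (Fin n) F) (e : ℕ) : Prop :=
  B ≠ 0 ∧ ∃ q : MvPowerSeries (Fin n) F,
    (B : MvPowerSeries (Fin n) F) * q = (A : MvPowerSeries (Fin n) F) ∧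
      q - (h : MvPowerSeries (Fin n) F) ∈ varIdeal F n ^ e

/-! The freedom that makes this work is that `B` may be a non-unit: power series are handled as
formal fractions of polynomials, and one may divide by any nonzero series as long as the quotient is
again a series. It also suffices to find `h` modulo `τ = x_{i₀} ^ (d + 1)`, which lies in `⟨x⟩ ^ (d
+ 1)`.

Let `h` be prime and `f = h ^ e * g` with `h ∤ g`. A generic line `b + a y` meets `h = 0` in `d`
simple points `y = ρ` where `g` does not vanish (`exists_line_roots`). If `w ≡ b` modulo `τ`, each
`ρ` lifts to a `τ`-adic root of `h (w + a y)`. Only `f` has a circuit, so Newton's iteration uses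
the correction `e f / f'`, adapted to a root of multiplicity `e` (`exists_newton_correction`). For
`e > 1` its denominator vanishes at the starting point, which is harmless for fractions; and `e`,
however large, is a single constant leaf. The product of the lifted roots then gives `h (w)` modulo
a power of `τ` (`pow_dvd_aeval_sub_prod`).

To reach the point `x`, consider `P (t) = h (b + (x - b) t)`, of degree at most `d` in `t`. The
nodes `t = 0, τ, …, d τ` give base points congruent to `b`, so the values there are available, and
Lagrange extrapolation gives `P 1 = h` (`pow_mul_eval_one_eq_sum`). It costs a division by `τ ^ d`,
so the values are needed modulo `τ ^ (d + 1)`.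

A general factor is a product of at most `d` primes, up to a constant. -/

section Circuits

variable {F : Type u} [Field F] {n : ℕ}

/-! ### Extending circuits and representing series as fractions -/

namespace AlgCircuit

lemma range_value_snoc {k : ℕ} (c : AlgCircuit F n k) (g : AlgGate F n k) :
    Set.range (c.snoc g).value = insert (g.eval c.value) (Set.range c.value) := by
  simp only [value, Fin.range_snoc]

/-- Appending a gate makes the polynomial computed by the gate available. -/
lemma exists_snoc {k : ℕ} (c : AlgCircuit F n k) (g : AlgGate F n k) :
    ∃ (k' : ℕ) (c' : AlgCircuit F n k'), c'.size = c.size + (1 + g.fanIn) ∧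
      Set.range c.value ⊆ Set.range c'.value ∧ g.eval c.value ∈ Set.range c'.value :=
  ⟨_, c.snoc g, by simp [size, add_assoc], by rw [range_value_snoc]; exact Set.subset_insert _ _,
    by rw [range_value_snoc]; exact Set.mem_insert _ _⟩

lemma exists_mul {k : ℕ} (c : AlgCircuit F n k) {p q : MvPolynomial (Fin n) F}
    (hp : p ∈ Set.range c.value) (hq : q ∈ Set.range c.value) :
    ∃ (k' : ℕ) (c' : AlgCircuit F n k'), c'.size = c.size + 3 ∧
      Set.range c.value ⊆ Set.range c'.value ∧ p * q ∈ Set.range c'.value := by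
  obtain ⟨i, rfl⟩ := hp
  obtain ⟨j, rfl⟩ := hq
  simpa [AlgGate.fanIn, AlgGate.eval] using c.exists_snoc (.mul [i, j])

lemma exists_add {k : ℕ} (c : AlgCircuit F n k) {p q : MvPolynomial (Fin n) F}
    (hp : p ∈ Set.range c.value) (hq : q ∈ Set.range c.value) :
    ∃ (k' : ℕ) (c' : AlgCircuit F n k'), c'.size = c.size + 3 ∧
      Set.range c.value ⊆ Set.range c'.value ∧ p + q ∈ Set.range c'.value := by
  obtain ⟨i, rfl⟩ := hp
  obtain ⟨j, rfl⟩ := hq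
  simpa [AlgGate.fanIn, AlgGate.eval] using c.exists_snoc (.add [i, j])

/-- The power series `r` is a quotient of two polynomials computed at nodes of `c`. -/
def HasQuotient {k : ℕ} (c : AlgCircuit F n k) (r : MvPowerSeries (Fin n) F) : Prop :=
  ∃ A ∈ Set.range c.value, ∃ B ∈ Set.range c.value, B ≠ 0 ∧
    (B : MvPowerSeries (Fin n) F) * r = (A : MvPowerSeries (Fin n) F)

lemma HasQuotient.mono {k k' : ℕ} {c : AlgCircuit F n k} {c' : AlgCircuit F n k'}
    (h : Set.range c.value ⊆ Set.range c'.value) {r : MvPowerSeries (Fin n) F}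
    (hr : c.HasQuotient r) : c'.HasQuotient r := by
  obtain ⟨A, hA, B, hB, h0, he⟩ := hr
  exact ⟨A, h hA, B, h hB, h0, he⟩

end AlgCircuit

/-! ### Cost calculus for fractions -/

open AlgCircuit

/-- From quotients of polynomials representing the power series in `T`, a circuit can be extended
at cost at most `m` to obtain quotients representing the power series in `S`. -/
def Computes (T : Set (MvPowerSeries (Fin n) F)) (m : ℕ) (S : Set (MvPowerSeries (Fin n) F)) :
    Prop :=
  ∀ (k : ℕ) (c : AlgCircuit F n k), (∀ r ∈ T, c.HasQuotient r) →
    ∃ (k' : ℕ) (c' : AlgCircuit F n k'), c'.size ≤ c.size + m ∧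
      Set.range c.value ⊆ Set.range c'.value ∧ ∀ r ∈ S, c'.HasQuotient r

namespace Computes

variable {T T' S S' : Set (MvPowerSeries (Fin n) F)} {m m' : ℕ} {r r' q : MvPowerSeries (Fin n) F}

lemma of_subset (h : S ⊆ T) : Computes T 0 S :=
  fun k c hc => ⟨k, c, le_rfl, subset_rfl, fun r hr => hc r (h hr)⟩

lemma of_mem (h : r ∈ T) : Computes T 0 {r} := of_subset (by simpa using h)

lemma mono (h : Computes T m S) (hT : T ⊆ T') (hm : m ≤ m') (hS : S' ⊆ S) :
    Computes T' m' S' := fun k c hc => by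
  obtain ⟨k', c', h1, h2, h3⟩ := h k c fun r hr => hc r (hT hr)
  exact ⟨k', c', h1.trans (by omega), h2, fun r hr => h3 r (hS hr)⟩

lemma mono_left (h : Computes T m S) (hT : T ⊆ T') : Computes T' m S :=
  h.mono hT le_rfl subset_rfl

lemma mono_cost (h : Computes T m S) (hm : m ≤ m') : Computes T m' S :=
  h.mono subset_rfl hm subset_rfl

/-- The circuit only grows, so earlier results stay available at no charge; costs add, and a shared
intermediate result is paid for once. -/
lemma trans (h : Computes T m S) (h' : Computes (T ∪ S) m' S') :
    Computes T (m + m') (S ∪ S') := fun k c hc => by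
  obtain ⟨k₁, c₁, h1, h2, h3⟩ := h k c hc
  obtain ⟨k₂, c₂, h4, h5, h6⟩ := h' k₁ c₁ fun r hr =>
    hr.elim (fun hr => (hc r hr).mono h2) (fun hr => h3 r hr)
  exact ⟨k₂, c₂, by omega, h2.trans h5, fun r hr =>
    hr.elim (fun hr => (h3 r hr).mono h5) (fun hr => h6 r hr)⟩

lemma trans_right (h : Computes T m S) (h' : Computes (T ∪ S) m' S') :
    Computes T (m + m') S' :=
  (h.trans h').mono subset_rfl le_rfl Set.subset_union_right

lemma union (h : Computes T m S) (h' : Computes T m' S') : Computes T (m + m') (S ∪ S') :=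
  h.trans (h'.mono_left Set.subset_union_left)

lemma const (a : F) : Computes T 2 {(MvPowerSeries.C a : MvPowerSeries (Fin n) F)} :=
    fun k c _ => by
  obtain ⟨k₁, c₁, h1, h2, h3⟩ := c.exists_snoc (.const a)
  obtain ⟨k₂, c₂, h4, h5, h6⟩ := c₁.exists_snoc (.const 1)
  simp only [AlgGate.fanIn, AlgGate.eval, map_one] at *
  refine ⟨k₂, c₂, by omega, h2.trans h5, ?_⟩
  rintro _ rfl
  exact ⟨_, h5 h3, _, h6, one_ne_zero, by simp⟩

lemma X (i : Fin n) : Computes T 2 {(MvPowerSeries.X i : MvPowerSeries (Fin n) F)} :=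
    fun k c _ => by
  obtain ⟨k₁, c₁, h1, h2, h3⟩ := c.exists_snoc (.var i)
  obtain ⟨k₂, c₂, h4, h5, h6⟩ := c₁.exists_snoc (.const 1)
  simp only [AlgGate.fanIn, AlgGate.eval, map_one] at *
  refine ⟨k₂, c₂, by omega, h2.trans h5, ?_⟩
  rintro _ rfl
  exact ⟨_, h5 h3, _, h6, one_ne_zero, by simp⟩

lemma mul_of_mem (h : r ∈ T) (h' : r' ∈ T) : Computes T 6 {r * r'} := fun k c hc => by
  obtain ⟨A, hA, B, hB, hB0, hr⟩ := hc r h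
  obtain ⟨A', hA', B', hB', hB0', hr'⟩ := hc r' h'
  obtain ⟨k₁, c₁, h1, h2, h3⟩ := c.exists_mul hA hA'
  obtain ⟨k₂, c₂, h4, h5, h6⟩ := c₁.exists_mul (h2 hB) (h2 hB')
  refine ⟨k₂, c₂, by omega, h2.trans h5, ?_⟩
  rintro _ rfl
  refine ⟨_, h5 h3, _, h6, mul_ne_zero hB0 hB0', ?_⟩
  rw [MvPolynomial.coe_mul, MvPolynomial.coe_mul, ← hr, ← hr']
  ring

lemma add_of_mem (h : r ∈ T) (h' : r' ∈ T) : Computes T 12 {r + r'} := fun k c hc => by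
  obtain ⟨A, hA, B, hB, hB0, hr⟩ := hc r h
  obtain ⟨A', hA', B', hB', hB0', hr'⟩ := hc r' h'
  obtain ⟨k₁, c₁, h1, h2, h3⟩ := c.exists_mul hA hB'
  obtain ⟨k₂, c₂, h4, h5, h6⟩ := c₁.exists_mul (h2 hB) (h2 hA')
  obtain ⟨k₃, c₃, h7, h8, h9⟩ := c₂.exists_mul (h5 (h2 hB)) (h5 (h2 hB'))
  obtain ⟨k₄, c₄, h10, h11, h12⟩ := c₃.exists_add (h8 (h5 h3)) (h8 h6)
  refine ⟨k₄, c₄, by omega, h2.trans (h5.trans (h8.trans h11)), ?_⟩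
  rintro _ rfl
  refine ⟨_, h12, _, h11 h9, mul_ne_zero hB0 hB0', ?_⟩
  rw [MvPolynomial.coe_add, MvPolynomial.coe_mul, MvPolynomial.coe_mul, MvPolynomial.coe_mul,
    ← hr, ← hr']
  ring

/-- The fraction `(A B') / (B A')` represents `q` even when `r'` is not a unit; only the existence
of `q` as a series matters. Newton's correction and the division by `τ ^ d` both depend on this. -/
lemma div_of_mem (h : r ∈ T) (h' : r' ∈ T) (h0 : r' ≠ 0) (hq : r' * q = r) :
    Computes T 6 {q} := fun k c hc => by
  obtain ⟨A, hA, B, hB, hB0, hr⟩ := hc r h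
  obtain ⟨A', hA', B', hB', hB0', hr'⟩ := hc r' h'
  obtain ⟨k₁, c₁, h1, h2, h3⟩ := c.exists_mul hA hB'
  obtain ⟨k₂, c₂, h4, h5, h6⟩ := c₁.exists_mul (h2 hB) (h2 hA')
  refine ⟨k₂, c₂, by omega, h2.trans h5, ?_⟩
  rintro _ rfl
  have hA0 : A' ≠ 0 := by
    rintro rfl
    rw [MvPolynomial.coe_zero] at hr'
    exact (mul_eq_zero.1 hr').elim (fun h => hB0' (by simpa using h)) h0
  refine ⟨_, h5 h3, _, h6, mul_ne_zero hB0 hA0, ?_⟩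
  rw [MvPolynomial.coe_mul, MvPolynomial.coe_mul, ← hr, ← hr', ← hq]
  ring

lemma mul (h : Computes T m {r}) (h' : Computes T m' {r'}) :
    Computes T (m + m' + 6) {r * r'} :=
  (h.union h').trans_right (mul_of_mem (by simp) (by simp))

lemma add (h : Computes T m {r}) (h' : Computes T m' {r'}) :
    Computes T (m + m' + 12) {r + r'} :=
  (h.union h').trans_right (add_of_mem (by simp) (by simp))

lemma div (h : Computes T m {r}) (h' : Computes T m' {r'}) (h0 : r' ≠ 0) (hq : r' * q = r) :
    Computes T (m + m' + 6) {q} :=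
  (h.union h').trans_right (div_of_mem (r := r) (r' := r') (by simp) (by simp) h0 hq)

lemma neg (h : Computes T m {r}) : Computes T (m + 8) {-r} := by
  have := ((const (-1)).mul h).mono_cost (m' := m + 8) (by omega)
  rwa [map_neg, map_one, neg_one_mul] at this

lemma sub (h : Computes T m {r}) (h' : Computes T m' {r'}) :
    Computes T (m + m' + 20) {r - r'} := by
  have := h.add h'.neg
  rw [← sub_eq_add_neg] at this
  exact this.mono_cost (by omega)

lemma sum {ι : Type*} (s : Finset ι) (v : ι → MvPowerSeries (Fin n) F)
    (h : ∀ i ∈ s, Computes T m {v i}) : Computes T (2 + s.card * (m + 12)) {∑ i ∈ s, v i} := by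
  classical
  induction s using Finset.induction_on with
  | empty => simpa using const (T := T) (n := n) (0 : F)
  | insert i s hi ih =>
    rw [Finset.sum_insert hi, Finset.card_insert_of_notMem hi]
    exact ((h i (Finset.mem_insert_self _ _)).add
      (ih fun j hj => h j (Finset.mem_insert_of_mem hj))).mono_cost (le_of_eq (by ring))

lemma prod {ι : Type*} (s : Finset ι) (v : ι → MvPowerSeries (Fin n) F)
    (h : ∀ i ∈ s, Computes T m {v i}) : Computes T (2 + s.card * (m + 6)) {∏ i ∈ s, v i} := by
  classical
  induction s using Finset.induction_on with
  | empty => simpa using const (T := T) (n := n) (1 : F)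
  | insert i s hi ih =>
    rw [Finset.prod_insert hi, Finset.card_insert_of_notMem hi]
    exact ((h i (Finset.mem_insert_self _ _)).mul
      (ih fun j hj => h j (Finset.mem_insert_of_mem hj))).mono_cost (le_of_eq (by ring))

lemma pow (h : Computes T m {r}) (e : ℕ) : Computes T (2 + e * (m + 6)) {r ^ e} := by
  simpa using prod (Finset.range e) (fun _ => r) fun _ _ => h

/-- A power series computable from nothing is a quotient of polynomials with small circuits. -/
lemma exists_hasCircuitOfSize (h : Computes ∅ m {q}) :
    ∃ A B : MvPolynomial (Fin n) F, HasCircuitOfSize m A ∧ HasCircuitOfSize m B ∧ B ≠ 0 ∧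
      (B : MvPowerSeries (Fin n) F) * q = (A : MvPowerSeries (Fin n) F) := by
  obtain ⟨k, c, h1, -, h3⟩ := h 0 .nil (by simp)
  obtain ⟨_, ⟨i, rfl⟩, _, ⟨j, rfl⟩, hB, he⟩ := h3 q rfl
  have h1 : c.size ≤ m := by simpa [AlgCircuit.size] using h1
  exact ⟨_, _, ⟨k, c, i, rfl, h1⟩, ⟨k, c, j, rfl, h1⟩, hB, he⟩

end Computes

end Circuits

/-! ### Evaluating a circuit and its directional derivative at power series -/

section Simulation

variable {F : Type u} [Field F] {n : ℕ}

/-- The directional derivative of polynomials along `a`. -/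
noncomputable def dirDeriv (a : Fin n → F) :
    Derivation F (MvPolynomial (Fin n) F) (MvPolynomial (Fin n) F) :=
  mkDerivation F fun i => C (a i)

@[simp] lemma dirDeriv_X (a : Fin n → F) (i : Fin n) : dirDeriv a (X i) = C (a i) :=
  mkDerivation_X _ _ _

@[simp] lemma dirDeriv_C (a : Fin n → F) (c : F) : dirDeriv a (C c) = 0 :=
  derivation_C _ _

lemma aeval_C_eq_C (w : Fin n → MvPowerSeries (Fin n) F) (c : F) :
    aeval w (C c) = MvPowerSeries.C c := by
  rw [← MvPolynomial.algebraMap_eq, AlgHom.commutes, MvPowerSeries.algebraMap_apply]; rfl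

namespace Computes

variable {T : Set (MvPowerSeries (Fin n) F)} {m : ℕ}

/-- The value of a gate and its directional derivative are computable from those of its inputs. -/
lemma gate {k : ℕ} (a : Fin n → F) (w : Fin n → MvPowerSeries (Fin n) F)
    (hw : ∀ i, Computes T m {w i}) (v : Fin k → MvPolynomial (Fin n) F)
    (hv : ∀ i, aeval w (v i) ∈ T) (hv' : ∀ i, aeval w (dirDeriv a (v i)) ∈ T)
    (g : AlgGate F n k) :
    Computes T ((1 + g.fanIn) * (m + 34))
      {aeval w (g.eval v), aeval w (dirDeriv a (g.eval v))} := by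
  cases g with
  | var i =>
    simp only [AlgGate.eval, AlgGate.fanIn, aeval_X, dirDeriv_X, aeval_C_eq_C]
    exact ((hw i).union (const (a i))).mono_cost (by omega)
  | const c =>
    simp only [AlgGate.eval, AlgGate.fanIn, dirDeriv_C, aeval_C_eq_C, map_zero]
    have h0 := const (T := T) (n := n) (0 : F)
    rw [map_zero] at h0
    exact ((const c).union h0).mono_cost (by omega)
  | add l =>
    simp only [AlgGate.eval, AlgGate.fanIn]
    -- Two constants for the empty sum, then two additions of cost 12 per input.
    suffices h : Computes T (4 + l.length * 24)
        {aeval w (l.map v).sum, aeval w (dirDeriv a (l.map v).sum)} from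
      h.mono_cost (by nlinarith [Nat.zero_le (l.length * m)])
    induction l with
    | nil =>
      have h0 := const (T := T) (n := n) (0 : F)
      rw [map_zero] at h0
      simpa using h0.mono_cost (m' := 4) (by omega)
    | cons i l ih =>
      rw [List.map_cons, List.sum_cons, map_add, map_add, map_add, List.length_cons]
      refine (ih.trans_right ((add_of_mem (r := aeval w (v i)) ?_ ?_).union
        (add_of_mem (r := aeval w (dirDeriv a (v i))) ?_ ?_))).mono_cost (by omega)
      all_goals simp [hv i, hv' i]
  | mul l =>
    simp only [AlgGate.eval, AlgGate.fanIn]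
    -- Per input, one product for the value (6), and two products and a sum for the Leibniz rule
    -- (24).
    suffices h : Computes T (4 + l.length * 30)
        {aeval w (l.map v).prod, aeval w (dirDeriv a (l.map v).prod)} from
      h.mono_cost (by nlinarith [Nat.zero_le (l.length * m)])
    induction l with
    | nil =>
      have h0 := const (T := T) (n := n) (0 : F)
      have h1 := const (T := T) (n := n) (1 : F)
      rw [map_zero] at h0
      rw [map_one] at h1
      simpa only [List.map_nil, List.prod_nil, map_one, Derivation.map_one_eq_zero, map_zero,
        List.length_nil, zero_mul, add_zero, Set.singleton_union] using h1.union h0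
    | cons i l ih =>
      rw [List.map_cons, List.prod_cons, Derivation.leibniz, map_mul, map_add, smul_eq_mul,
        smul_eq_mul, map_mul, map_mul, List.length_cons]
      refine (ih.trans_right ((mul_of_mem (r := aeval w (v i)) ?_ ?_).union
        (add (mul_of_mem (r := aeval w (v i)) ?_ ?_)
          (mul_of_mem (r' := aeval w (dirDeriv a (v i))) ?_ ?_)))).mono_cost (by omega)
      all_goals simp [hv i, hv' i]

/-- Forward-mode differentiation: values and derivatives are propagated together through all nodes,
so each gate is simulated once whatever its fan-out. -/
lemma circuit {k : ℕ} (a : Fin n → F) (w : Fin n → MvPowerSeries (Fin n) F)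
    (hw : ∀ i, Computes T m {w i}) (c : AlgCircuit F n k) :
    Computes T (c.size * (m + 34))
      ((fun p => aeval w p) '' Set.range c.value ∪
        (fun p => aeval w (dirDeriv a p)) '' Set.range c.value) := by
  induction c with
  | nil => simpa [AlgCircuit.size] using of_subset (Set.empty_subset T)
  | snoc c g ih =>
    refine (ih.trans (gate a w (fun i => (hw i).mono_left Set.subset_union_left) c.value
      (fun i => .inr (.inl ⟨_, ⟨i, rfl⟩, rfl⟩)) (fun i => .inr (.inr ⟨_, ⟨i, rfl⟩, rfl⟩)) g)).mono
      subset_rfl (le_of_eq (by rw [AlgCircuit.size]; ring)) ?_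
    rw [AlgCircuit.range_value_snoc, Set.image_insert_eq, Set.image_insert_eq]
    rintro x ((rfl | h) | (rfl | h))
    · simp
    · exact .inl (.inl h)
    · simp
    · exact .inl (.inr h)

/-- A polynomial with a small circuit and its directional derivative can be evaluated cheaply at
power series. -/
lemma aeval_dirDeriv {s : ℕ} {f : MvPolynomial (Fin n) F} (hf : HasCircuitOfSize s f)
    (a : Fin n → F) (w : Fin n → MvPowerSeries (Fin n) F) (hw : ∀ i, Computes T m {w i}) :
    Computes T (s * (m + 34)) {aeval w f, aeval w (dirDeriv a f)} := by
  obtain ⟨k, c, i, rfl, hs⟩ := hf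
  refine (circuit a w hw c).mono subset_rfl (Nat.mul_le_mul_right _ hs) ?_
  rintro x (rfl | rfl)
  · exact .inl ⟨_, ⟨i, rfl⟩, rfl⟩
  · exact .inr ⟨_, ⟨i, rfl⟩, rfl⟩

end Computes

end Simulation

/-! ### Restriction to a line -/

section Line

variable {F : Type u} [Field F] {n : ℕ} {A B : Type*} [CommRing A] [Algebra F A] [CommRing B]
  [Algebra F B]

/-- The restriction of polynomials to the line `w + a y`, as polynomials in `y`. -/
noncomputable def onLine (w : Fin n → A) (a : Fin n → F) :
    MvPolynomial (Fin n) F →ₐ[F] Polynomial A :=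
  aeval fun i => Polynomial.C (w i) + Polynomial.C (algebraMap F A (a i)) * Polynomial.X

@[simp] lemma onLine_X (w : Fin n → A) (a : Fin n → F) (i : Fin n) : onLine w a (X i) =
    Polynomial.C (w i) + Polynomial.C (algebraMap F A (a i)) * Polynomial.X := by
  simp [onLine]

lemma onLine_C (w : Fin n → A) (a : Fin n → F) (c : F) :
    onLine w a (C c) = Polynomial.C (algebraMap F A c) := by
  rw [← MvPolynomial.algebraMap_eq, AlgHom.commutes]; rfl

lemma derivative_onLine (w : Fin n → A) (a : Fin n → F) (p : MvPolynomial (Fin n) F) :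
    Polynomial.derivative (onLine w a p) = onLine w a (dirDeriv a p) := by
  induction p using MvPolynomial.induction_on with
  | C c => simp
  | add p q hp hq => simp [hp, hq]
  | mul_X p i hp =>
    rw [Derivation.leibniz, map_mul, Polynomial.derivative_mul, hp]
    simp
    ring

lemma eval_onLine (w : Fin n → A) (a : Fin n → F) (y : A) (p : MvPolynomial (Fin n) F) :
    (onLine w a p).eval y = aeval (fun i => w i + algebraMap F A (a i) * y) p := by
  induction p using MvPolynomial.induction_on with
  | C c => rw [onLine_C, ← MvPolynomial.algebraMap_eq, AlgHom.commutes, Polynomial.eval_C]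
  | add p q hp hq => simp [hp, hq]
  | mul_X p i hp => simp [hp]

lemma map_onLine (φ : A →ₐ[F] B) (w : Fin n → A) (a : Fin n → F) (p : MvPolynomial (Fin n) F) :
    (onLine w a p).map (φ : A →+* B) = onLine (fun i => φ (w i)) a p := by
  induction p using MvPolynomial.induction_on with
  | C c => simp
  | add p q hp hq => simp [hp, hq]
  | mul_X p i hp => simp [hp]

lemma natDegree_prod_le_and_coeff {ι : Type*} (s : Finset ι) (f : ι → Polynomial A) (k : ι → ℕ)
    (h : ∀ i ∈ s, (f i).natDegree ≤ k i) :
    (∏ i ∈ s, f i).natDegree ≤ ∑ i ∈ s, k i ∧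
      (∏ i ∈ s, f i).coeff (∑ i ∈ s, k i) = ∏ i ∈ s, (f i).coeff (k i) := by
  classical
  induction s using Finset.induction_on with
  | empty => simp
  | insert i s hi ih =>
    obtain ⟨h1, h2⟩ := ih fun j hj => h j (Finset.mem_insert_of_mem hj)
    have h3 := h i (Finset.mem_insert_self _ _)
    rw [Finset.prod_insert hi, Finset.sum_insert hi, Finset.prod_insert hi]
    exact ⟨Polynomial.natDegree_mul_le.trans (add_le_add h3 h1), by
      rw [Polynomial.coeff_mul_add_eq_of_natDegree_le h3 h1, h2]⟩

/-- Each variable becomes linear in `y` with slope `a i`, so the coefficient at `y ^ m.degree`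
depends on `a` only and not on the base point. Hence `coeff_onLine_totalDegree`: the leading
coefficient on the line is the leading form at `a`, a constant. -/
lemma natDegree_coeff_onLine_monomial (w : Fin n → A) (a : Fin n → F) (m : Fin n →₀ ℕ) (c : F) :
    (onLine w a (monomial m c)).natDegree ≤ m.degree ∧
      (onLine w a (monomial m c)).coeff m.degree = algebraMap F A (eval a (monomial m c)) := by
  have hL : ∀ i, (Polynomial.C (w i) +
      Polynomial.C (algebraMap F A (a i)) * Polynomial.X).natDegree ≤ 1 := fun i => by
    compute_degree
  have h := natDegree_prod_le_and_coeff Finset.univ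
    (fun i => (Polynomial.C (w i) + Polynomial.C (algebraMap F A (a i)) * Polynomial.X) ^ m i) m
    fun i _ => (Polynomial.natDegree_pow_le_of_le (m i) (hL i)).trans (by simp)
  have hd : m.degree = ∑ i, m i := Finsupp.degree_eq_sum m
  have hm : onLine w a (monomial m c) = Polynomial.C (algebraMap F A c) *
      ∏ i, (Polynomial.C (w i) + Polynomial.C (algebraMap F A (a i)) * Polynomial.X) ^ m i := by
    rw [onLine, aeval_monomial, Finsupp.prod_fintype _ _ (by simp)]; rfl
  rw [hm, hd, Polynomial.coeff_C_mul, h.2, eval_monomial, Finsupp.prod_fintype _ _ (by simp)]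
  refine ⟨(Polynomial.natDegree_C_mul_le _ _).trans h.1, ?_⟩
  rw [map_mul, map_prod]
  congr 1
  refine Finset.prod_congr rfl fun i _ => ?_
  have := Polynomial.coeff_pow_of_natDegree_le (m := m i) (hL i)
  rw [mul_one] at this
  rw [this]
  simp

lemma natDegree_onLine_le (w : Fin n → A) (a : Fin n → F) (p : MvPolynomial (Fin n) F) :
    (onLine w a p).natDegree ≤ p.totalDegree := by
  conv_lhs => rw [p.as_sum, map_sum]
  refine Polynomial.natDegree_sum_le_of_forall_le _ _ fun m hm => ?_
  exact (natDegree_coeff_onLine_monomial w a m _).1.trans (le_totalDegree hm)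

lemma coeff_onLine_totalDegree (w : Fin n → A) (a : Fin n → F) (p : MvPolynomial (Fin n) F) :
    (onLine w a p).coeff p.totalDegree =
      algebraMap F A (eval a (homogeneousComponent p.totalDegree p)) := by
  conv_lhs => rw [p.as_sum, map_sum, ← p.as_sum]
  rw [Polynomial.finsetSum_coeff, homogeneousComponent_apply, map_sum, map_sum, Finset.sum_filter]
  refine Finset.sum_congr rfl fun m hm => ?_
  obtain ⟨h1, h2⟩ := natDegree_coeff_onLine_monomial w a m (p.coeff m)
  split_ifs with h
  · rw [← h2, h]
  · exact Polynomial.coeff_eq_zero_of_natDegree_lt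
      (h1.trans_lt (lt_of_le_of_ne (le_totalDegree hm) h))

end Line

/-! ### Generic lines -/

section Generic

variable {F : Type u} [Field F] {n : ℕ}

lemma exists_eval_homogeneousComponent_ne_zero [Infinite F] {p : MvPolynomial (Fin n) F}
    (hp : p ≠ 0) : ∃ a : Fin n → F, eval a (homogeneousComponent p.totalDegree p) ≠ 0 := by
  by_contra! h
  have h0 : homogeneousComponent p.totalDegree p = 0 := MvPolynomial.funext (by simpa using h)
  obtain ⟨m, hm, hd⟩ := Finset.exists_mem_eq_sup p.support (support_nonempty.2 hp)
    fun s => s.sum fun _ e => e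
  have := congrArg (coeff m) h0
  rw [coeff_homogeneousComponent, if_pos, coeff_zero] at this
  · exact mem_support_iff.1 hm this
  · exact hd.symm

/-- The change of variables `x_i ↦ x_i + a_i y`. -/
noncomputable def shear (a : Fin n → F) :
    Polynomial (MvPolynomial (Fin n) F) →ₐ[F] Polynomial (MvPolynomial (Fin n) F) :=
  { Polynomial.eval₂RingHom (onLine (X : Fin n → MvPolynomial (Fin n) F) a : _ →+* _)
      Polynomial.X with
    commutes' := fun c => by
      rw [Polynomial.algebraMap_apply, MvPolynomial.algebraMap_eq]
      simp }

lemma shear_X (a : Fin n → F) : shear a Polynomial.X = Polynomial.X := by simp [shear]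

lemma shear_C (a : Fin n → F) (p : MvPolynomial (Fin n) F) :
    shear a (Polynomial.C p) = onLine X a p := by simp [shear]

/-- Since the shear is invertible, primality and non-divisibility pass from `h` and `g` to their
restrictions to the generic line. -/
lemma shear_neg_shear (a : Fin n → F) (P : Polynomial (MvPolynomial (Fin n) F)) :
    shear (-a) (shear a P) = P := by
  have h : ∀ p : MvPolynomial (Fin n) F,
      shear (-a) (shear a (Polynomial.C p)) = Polynomial.C p := fun p => by
    induction p using MvPolynomial.induction_on with
    | C c => rw [shear_C, onLine_C, shear_C, MvPolynomial.algebraMap_eq, onLine_C]; rfl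
    | add p q hp hq => simp only [map_add, hp, hq]
    | mul_X p i hp =>
      rw [map_mul, map_mul, map_mul, hp, shear_C a, onLine_X, map_add, map_mul, shear_X, shear_C,
        shear_C, onLine_X, MvPolynomial.algebraMap_eq, onLine_C]
      simp
  induction P using Polynomial.induction_on' with
  | add p q hp hq => simp only [map_add, hp, hq]
  | monomial k p => rw [← Polynomial.C_mul_X_pow_eq_monomial, map_mul, map_mul, h, map_pow,
      map_pow, shear_X, shear_X]

/-- The change of variables `x_i ↦ x_i + a_i y` as an automorphism. -/
noncomputable def shearEquiv (a : Fin n → F) :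
    Polynomial (MvPolynomial (Fin n) F) ≃ₐ[F] Polynomial (MvPolynomial (Fin n) F) :=
  AlgEquiv.ofAlgHom (shear a) (shear (-a))
    (AlgHom.ext fun P => by simpa using shear_neg_shear (-a) P)
    (AlgHom.ext fun P => shear_neg_shear a P)

lemma shearEquiv_C (a : Fin n → F) (p : MvPolynomial (Fin n) F) :
    shearEquiv a (Polynomial.C p) = onLine X a p := shear_C a p

/-- On a generic line in a direction where the leading form of the prime polynomial `h` does not
vanish, `h` is separable and coprime to any fixed polynomial that it does not divide. -/
lemma exists_generic_line [CharZero F] {h g : MvPolynomial (Fin n) F} (hh : Prime h)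
    (hd : h.totalDegree ≠ 0) (hg : ¬ h ∣ g) (a : Fin n → F)
    (ha : eval a (homogeneousComponent h.totalDegree h) ≠ 0) :
    ∃ b : Fin n → F,
      IsCoprime (onLine b a h) (Polynomial.derivative (onLine b a h) * onLine b a g) := by
  set c := eval a (homogeneousComponent h.totalDegree h) with hc
  set H := onLine (X : Fin n → MvPolynomial (Fin n) F) a h with hH
  have hcoeff : H.coeff h.totalDegree = C c := coeff_onLine_totalDegree _ a h
  have hdeg : H.natDegree = h.totalDegree := le_antisymm (natDegree_onLine_le _ a h)
    (Polynomial.le_natDegree_of_ne_zero (by rw [hcoeff]; simpa using ha))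
  have hprime : Prime H := by
    rw [hH, ← shearEquiv_C]
    exact (MulEquiv.prime_iff (shearEquiv a)).2 (Polynomial.prime_C_iff.2 hh)
  have hgH : ¬ H ∣ onLine X a g := by
    rw [hH, ← shearEquiv_C, ← shearEquiv_C, map_dvd_iff, Polynomial.C_dvd_iff_dvd_coeff]
    exact fun H => hg (by simpa using H 0)
  have hH' : ¬ H ∣ Polynomial.derivative H := fun hdvd => by
    have := Polynomial.eq_zero_of_dvd_of_degree_lt hdvd
      (Polynomial.degree_derivative_lt hprime.ne_zero)
    exact hd (hdeg ▸ Polynomial.derivative_eq_zero.1 this)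
  have hcu : IsUnit (Polynomial.C (C c⁻¹ : MvPolynomial (Fin n) F)) :=
    ((isUnit_iff_ne_zero.2 (inv_ne_zero ha)).map C).map Polynomial.C
  -- The leading coefficient of `H` in `y` is the constant `c`, so `H` is monic up to a unit and the
  -- quotient by it is integral over the coefficient ring.
  set M := Polynomial.C (C c⁻¹ : MvPolynomial (Fin n) F) * H with hM
  have hassoc : Associated H M := ⟨hcu.unit, by rw [mul_comm]; rfl⟩
  have hMmonic : M.Monic := by
    refine Polynomial.monic_of_natDegree_le_of_coeff_eq_one h.totalDegree
      ((Polynomial.natDegree_C_mul_le _ _).trans hdeg.le) ?_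
    rw [hM, Polynomial.coeff_C_mul, hcoeff, ← C_mul, inv_mul_cancel₀ ha, C_1]
  have : IsDomain (AdjoinRoot M) := AdjoinRoot.isDomain_of_prime (hassoc.prime hprime)
  have : Module.Finite (MvPolynomial (Fin n) F) (AdjoinRoot M) := hMmonic.finite_adjoinRoot
  have hne : AdjoinRoot.mk M (Polynomial.derivative H * onLine X a g) ≠ 0 := by
    rw [Ne, AdjoinRoot.mk_eq_zero, ← hassoc.dvd_iff_dvd_left]
    exact hprime.not_dvd_mul hH' hgH
  -- In an integral extension domain a nonzero element divides some nonzero `r` of the base ring.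
  -- This `r` plays the role of a resultant: the line is good wherever `r` does not vanish.
  obtain ⟨r, hr, V, hV⟩ := (Algebra.IsIntegral.isIntegral (R := MvPolynomial (Fin n) F)
    (AdjoinRoot.mk M (Polynomial.derivative H * onLine X a g))).isAlgebraic.exists_nonzero_dvd
      (mem_nonZeroDivisors_of_ne_zero hne)
  obtain ⟨V, rfl⟩ := AdjoinRoot.mk_surjective V
  rw [AdjoinRoot.algebraMap_eq, ← AdjoinRoot.mk_C, ← map_mul, AdjoinRoot.mk_eq_mk] at hV
  obtain ⟨U, hU⟩ := hassoc.dvd.trans hV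
  obtain ⟨b, hb⟩ : ∃ b : Fin n → F, eval b r ≠ 0 := by
    by_contra! hcon
    exact hr (MvPolynomial.funext (by simpa using hcon))
  refine ⟨b, ?_⟩
  have hmap : ∀ p, (onLine (X : Fin n → MvPolynomial (Fin n) F) a p).map (eval b) =
      onLine b a p := fun p => by
    have := map_onLine (aeval b : MvPolynomial (Fin n) F →ₐ[F] F) X a p
    simpa [coe_aeval_eq_eval] using this
  have key := congrArg (Polynomial.map (eval b)) hU
  rw [Polynomial.map_sub, Polynomial.map_mul, Polynomial.map_mul, Polynomial.map_mul,
    ← Polynomial.derivative_map, hmap, hmap, Polynomial.map_C] at key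
  refine ⟨Polynomial.C (eval b r)⁻¹ * U.map (eval b), Polynomial.C (eval b r)⁻¹ * V.map (eval b), ?_⟩
  have hone : Polynomial.C (eval b r)⁻¹ * Polynomial.C (eval b r) = 1 := by
    rw [← Polynomial.C_mul, inv_mul_cancel₀ hb, Polynomial.C_1]
  linear_combination hone - Polynomial.C (eval b r)⁻¹ * key

/-- On a generic line the prime factor `h` of degree `d` has `d` roots, which are simple and are
not roots of `g`. -/
lemma exists_line_roots [IsAlgClosed F] [CharZero F] {h g : MvPolynomial (Fin n) F}
    (hh : Prime h) (hd : h.totalDegree ≠ 0) (hg : ¬ h ∣ g) :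
    ∃ (a b : Fin n → F) (Z : Finset F), Z.card = h.totalDegree ∧
      eval a (homogeneousComponent h.totalDegree h) ≠ 0 ∧
      ∀ ρ ∈ Z, eval (fun i => b i + a i * ρ) h = 0 ∧
        eval (fun i => b i + a i * ρ) (dirDeriv a h) ≠ 0 ∧
        eval (fun i => b i + a i * ρ) g ≠ 0 := by
  classical
  obtain ⟨a, ha⟩ := exists_eval_homogeneousComponent_ne_zero hh.ne_zero
  obtain ⟨b, hb⟩ := exists_generic_line hh hd hg a ha
  have hdeg : (onLine b a h).natDegree = h.totalDegree := le_antisymm (natDegree_onLine_le _ a h)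
    (Polynomial.le_natDegree_of_ne_zero (by rw [coeff_onLine_totalDegree]; simpa using ha))
  have h0 : onLine b a h ≠ 0 := fun h0 => hd (by rw [← hdeg, h0, Polynomial.natDegree_zero])
  have heval : ∀ (ρ : F) (p : MvPolynomial (Fin n) F),
      (onLine b a p).eval ρ = eval (fun i => b i + a i * ρ) p := fun ρ p => by
    rw [eval_onLine, ← coe_aeval_eq_eval]; rfl
  refine ⟨a, b, (onLine b a h).roots.toFinset, ?_, ha, fun ρ hρ => ?_⟩
  · rw [Multiset.toFinset_card_of_nodup (Polynomial.nodup_roots hb.of_mul_right_left), ← hdeg]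
    exact (IsAlgClosed.splits _).natDegree_eq_card_roots.symm
  · have hroot : (onLine b a h).eval ρ = 0 :=
      (Polynomial.mem_roots h0).1 (Multiset.mem_toFinset.1 hρ)
    obtain ⟨U, V, hUV⟩ := hb
    have := congrArg (Polynomial.eval ρ) hUV
    rw [Polynomial.eval_add, Polynomial.eval_mul, hroot, mul_zero, zero_add, Polynomial.eval_mul,
      Polynomial.eval_mul, derivative_onLine, heval, heval, Polynomial.eval_one] at this
    refine ⟨by rw [← heval, hroot], fun h1 => ?_, fun h1 => ?_⟩ <;> simp [h1] at this

end Generic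

/-! ### Newton's iteration at a multiple root -/

section Newton

variable {F : Type u} [Field F] {n : ℕ}

lemma Computes.algebraMap {T : Set (MvPowerSeries (Fin n) F)} (a : F) :
    Computes T 2 {algebraMap F (MvPowerSeries (Fin n) F) a} := by
  simpa [MvPowerSeries.algebraMap_apply] using Computes.const (T := T) (n := n) a

lemma constantCoeff_eval_onLine {w : Fin n → MvPowerSeries (Fin n) F} {b : Fin n → F}
    (hw : ∀ i, MvPowerSeries.constantCoeff (w i) = b i) (a : Fin n → F)
    (φ : MvPowerSeries (Fin n) F) (p : MvPolynomial (Fin n) F) :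
    MvPowerSeries.constantCoeff ((onLine w a p).eval φ) =
      eval (fun i => b i + a i * MvPowerSeries.constantCoeff φ) p := by
  rw [eval_onLine]
  induction p using MvPolynomial.induction_on with
  | C c => rw [aeval_C_eq_C]; simp
  | add p q hp hq => simp [hp, hq]
  | mul_X p i hp =>
    rw [map_mul, map_mul, map_mul, hp]
    simp [hw, MvPowerSeries.algebraMap_apply]

/-- Polynomials respect congruences. Used to see that `ρ`, an exact root over `b`, is a root modulo
`τ` over `w`. -/
lemma dvd_aeval_sub_aeval {A : Type*} [CommRing A] [Algebra F A] {τ : A} {v w : Fin n → A}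
    (h : ∀ i, τ ∣ v i - w i) (p : MvPolynomial (Fin n) F) : τ ∣ aeval v p - aeval w p := by
  induction p using MvPolynomial.induction_on with
  | C c => simp
  | add p q hp hq =>
    rw [map_add, map_add, add_sub_add_comm]
    exact dvd_add hp hq
  | mul_X p i hp =>
    rw [map_mul, map_mul, aeval_X, aeval_X]
    have : aeval v p * v i - aeval w p * w i =
      (aeval v p - aeval w p) * v i + aeval w p * (v i - w i) := by ring
    rw [this]
    exact dvd_add (hp.mul_right _) ((h i).mul_left _)

/-- One step of Newton's iteration for a root of multiplicity `e`, carried out on `f = h ^ e * g`: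
the correction `q = e f / f'` satisfies `h (φ - q) ≡ 0` modulo `h (φ) ^ 2`. -/
lemma exists_newton_correction [CharZero F] {A : Type*} [CommRing A] [Algebra F A] {e : ℕ}
    (he : e ≠ 0) {f h g : MvPolynomial (Fin n) F} (hf : f = h ^ e * g) (w : Fin n → A)
    (a : Fin n → F) (φ : A)
    (hU : IsUnit ((e : A) * (onLine w a (dirDeriv a h)).eval φ * (onLine w a g).eval φ +
      (onLine w a h).eval φ * (onLine w a (dirDeriv a g)).eval φ)) :
    ∃ q, (onLine w a (dirDeriv a f)).eval φ * q = (e : A) * (onLine w a f).eval φ ∧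
      (onLine w a h).eval φ ∣ q ∧
      (onLine w a h).eval φ ^ 2 ∣ (onLine w a h).eval (φ - q) ∧
      ∃ u, IsUnit u ∧
        (onLine w a (dirDeriv a f)).eval φ = (onLine w a h).eval φ ^ (e - 1) * u := by
  obtain ⟨e, rfl⟩ : ∃ k, e = k + 1 := ⟨e - 1, by omega⟩
  obtain ⟨V, hV⟩ := hU.exists_right_inv
  have hf1 : (onLine w a (dirDeriv a f)).eval φ = (onLine w a h).eval φ ^ e *
      (((e + 1 : ℕ) : A) * (onLine w a (dirDeriv a h)).eval φ * (onLine w a g).eval φ +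
      (onLine w a h).eval φ * (onLine w a (dirDeriv a g)).eval φ) := by
    rw [hf, ← derivative_onLine, map_mul, map_pow, Polynomial.derivative_mul,
      Polynomial.derivative_pow_succ, derivative_onLine, derivative_onLine]
    simp only [Polynomial.eval_add, Polynomial.eval_mul, Polynomial.eval_pow, Polynomial.eval_C]
    push_cast
    ring
  have hf0 : (onLine w a f).eval φ = (onLine w a h).eval φ ^ (e + 1) * (onLine w a g).eval φ := by
    rw [hf]; simp
  set H := (onLine w a h).eval φ with hH
  set H' := (onLine w a (dirDeriv a h)).eval φ with hH'
  set G := (onLine w a g).eval φ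
  set G' := (onLine w a (dirDeriv a g)).eval φ
  refine ⟨((e + 1 : ℕ) : A) * H * G * V, ?_, ⟨((e + 1 : ℕ) : A) * G * V, by ring⟩, ?_, _, hU, hf1⟩
  · rw [hf1, hf0]
    linear_combination ((e + 1 : ℕ) : A) * H ^ (e + 1) * G * hV
  -- Taylor: `h (φ - q) = H - H' q + k q ^ 2`. With `V` the inverse of `e H' G + H G'` and `q = e H
  -- G V`, the first two terms add up to `H ^ 2 G' V`.
  · obtain ⟨k, hk⟩ := (onLine w a h).binomExpansion φ (-(((e + 1 : ℕ) : A) * H * G * V))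
    rw [derivative_onLine, ← hH, ← hH'] at hk
    rw [sub_eq_add_neg, hk]
    refine ⟨G' * V + k * (((e + 1 : ℕ) : A) * G * V) ^ 2, ?_⟩
    linear_combination (-H) * hV

/-- Newton's iteration computes approximations of a root of `h` on the line `w + a y`, of arbitrary
`τ`-adic precision, from a circuit for a multiple `f` of `h`. -/
lemma exists_approx_root [CharZero F] {e s m : ℕ} (he : e ≠ 0)
    {f h g : MvPolynomial (Fin n) F} (hf : f = h ^ e * g) (hs : HasCircuitOfSize s f)
    {T : Set (MvPowerSeries (Fin n) F)} {τ : MvPowerSeries (Fin n) F}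
    (hτ : MvPowerSeries.constantCoeff τ = 0) {w : Fin n → MvPowerSeries (Fin n) F}
    (hw : ∀ i, Computes T m {w i}) (a b : Fin n → F)
    (hwb : ∀ i, τ ∣ w i - algebraMap F (MvPowerSeries (Fin n) F) (b i)) {ρ : F}
    (h0 : eval (fun i => b i + a i * ρ) h = 0)
    (h1 : eval (fun i => b i + a i * ρ) (dirDeriv a h) ≠ 0)
    (h2 : eval (fun i => b i + a i * ρ) g ≠ 0) (k : ℕ) :
    ∃ φ : MvPowerSeries (Fin n) F, MvPowerSeries.constantCoeff φ = ρ ∧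
      τ ^ (k + 1) ∣ (onLine w a h).eval φ ∧
      Computes T (2 + k * (s * (m + 54) + 34)) {φ} := by
  have hwc : ∀ i, MvPowerSeries.constantCoeff (w i) = b i := fun i => by
    have := map_dvd MvPowerSeries.constantCoeff (hwb i)
    rw [hτ, zero_dvd_iff, map_sub, sub_eq_zero] at this
    simpa [MvPowerSeries.algebraMap_apply] using this
  induction k with
  | zero =>
    refine ⟨algebraMap F _ ρ, by simp [MvPowerSeries.algebraMap_apply], ?_, by
      simpa using Computes.algebraMap ρ⟩
    have := dvd_aeval_sub_aeval (τ := τ)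
      (v := fun i => w i + algebraMap F _ (a i) * algebraMap F _ ρ)
      (w := fun i => algebraMap F (MvPowerSeries (Fin n) F) (b i + a i * ρ))
      (fun i => by simpa using hwb i) h
    rw [eval_onLine, zero_add, pow_one]
    have h3 : aeval (fun i => algebraMap F (MvPowerSeries (Fin n) F) (b i + a i * ρ)) h = 0 := by
      have := MvPolynomial.aeval_algebraMap_apply (MvPowerSeries (Fin n) F)
        (fun i => b i + a i * ρ) h
      rw [show aeval (fun i => b i + a i * ρ) h = 0 from h0, map_zero] at this
      exact this
    rwa [h3, sub_zero] at this
  | succ k ih =>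
    obtain ⟨φ, hφ, hdvd, hcomp⟩ := ih
    -- At an exact root `f'` may vanish, so no division is possible, and none is needed.
    by_cases hH : (onLine w a h).eval φ = 0
    · exact ⟨φ, hφ, by rw [hH]; exact dvd_zero _, hcomp.mono_cost (by gcongr; omega)⟩
    have hHc : MvPowerSeries.constantCoeff ((onLine w a h).eval φ) = 0 := by
      rw [constantCoeff_eval_onLine hwc, hφ, h0]
    have hU : IsUnit ((e : MvPowerSeries (Fin n) F) * (onLine w a (dirDeriv a h)).eval φ *
        (onLine w a g).eval φ +
        (onLine w a h).eval φ * (onLine w a (dirDeriv a g)).eval φ) := by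
      rw [MvPowerSeries.isUnit_iff_constantCoeff, map_add, map_mul, map_mul, map_mul, hHc,
        constantCoeff_eval_onLine hwc, constantCoeff_eval_onLine hwc, hφ, map_natCast,
        zero_mul, add_zero, isUnit_iff_ne_zero]
      exact mul_ne_zero (mul_ne_zero (Nat.cast_ne_zero.2 he) h1) h2
    obtain ⟨q, hq, hqH, hqn, u, hu, hfu⟩ := exists_newton_correction he hf w a φ hU
    have hne : (onLine w a (dirDeriv a f)).eval φ ≠ 0 := by
      rw [hfu]; exact mul_ne_zero (pow_ne_zero _ hH) hu.ne_zero
    refine ⟨φ - q, ?_, ?_, ?_⟩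
    · have := map_dvd MvPowerSeries.constantCoeff hqH
      rw [hHc, zero_dvd_iff] at this
      rw [map_sub, hφ, this, sub_zero]
    · refine dvd_trans ?_ hqn
      -- The precision doubles, but one more power of `τ` per step already gives a polynomial bound.
      refine dvd_trans (pow_dvd_pow τ (show k + 1 + 1 ≤ (k + 1) * 2 by omega)) ?_
      rw [pow_mul]
      exact pow_dvd_pow_of_dvd hdvd 2
    · have hpt : ∀ i, Computes (T ∪ {φ}) (m + 20)
          {w i + algebraMap F (MvPowerSeries (Fin n) F) (a i) * φ} := fun i =>
        (((hw i).mono_left Set.subset_union_left).add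
          ((Computes.algebraMap (a i)).mul (.of_mem (by simp)))).mono_cost (by omega)
      have hsim := Computes.aeval_dirDeriv hs a _ hpt
      rw [← eval_onLine, ← eval_onLine] at hsim
      have hq' : Computes (T ∪ {φ} ∪
          {(onLine w a f).eval φ, (onLine w a (dirDeriv a f)).eval φ}) 34 {φ - q} := by
        have he' := Computes.algebraMap (T := T ∪ {φ} ∪
          {(onLine w a f).eval φ, (onLine w a (dirDeriv a f)).eval φ}) (e : F)
        rw [map_natCast] at he'
        exact ((Computes.of_mem (by simp)).sub ((he'.mul (.of_mem (by simp))).div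
          (.of_mem (by simp)) hne hq)).mono_cost (by omega)
      exact (hcomp.trans_right (hsim.trans_right hq')).mono_cost (by
        rw [show m + 20 + 34 = m + 54 by omega, add_mul, one_mul]; omega)

end Newton

/-! ### Factoring from roots, and extrapolation -/

section Interpolation

/-- A polynomial of degree at most `d` with `d` roots whose differences are units splits. -/
lemma eq_C_mul_prod_X_sub_C {A ι : Type*} [CommRing A] {p : Polynomial A} {Z : Finset ι}
    (hp : p.natDegree ≤ Z.card) (φ : ι → A) (h0 : ∀ ρ ∈ Z, p.eval (φ ρ) = 0)
    (hφ : ∀ ρ ∈ Z, ∀ σ ∈ Z, ρ ≠ σ → IsUnit (φ ρ - φ σ)) :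
    p = Polynomial.C (p.coeff Z.card) * ∏ ρ ∈ Z, (Polynomial.X - Polynomial.C (φ ρ)) := by
  nontriviality A
  set P := ∏ ρ ∈ Z, (Polynomial.X - Polynomial.C (φ ρ)) with hP
  have hmonic : P.Monic := Polynomial.monic_prod_of_monic _ _ fun _ _ => Polynomial.monic_X_sub_C _
  have hdeg : P.natDegree = Z.card := by
    rw [hP, Polynomial.natDegree_prod_of_monic _ _ fun _ _ => Polynomial.monic_X_sub_C _]
    simp
  have hdvd : P ∣ p := Finset.prod_dvd_of_coprime
    (fun ρ hρ σ hσ hne => Polynomial.isCoprime_X_sub_C_of_isUnit_sub (hφ ρ hρ σ hσ hne))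
    fun ρ hρ => Polynomial.dvd_iff_isRoot.2 (h0 ρ hρ)
  rw [← sub_eq_zero]
  by_contra hne
  refine hmonic.not_dvd_of_degree_lt hne ?_ (dvd_sub hdvd (dvd_mul_left _ _))
  rw [Polynomial.degree_eq_natDegree hmonic.ne_zero, hdeg, Polynomial.degree_lt_iff_coeff_zero]
  intro j hj
  rw [Polynomial.coeff_sub, Polynomial.coeff_C_mul]
  rcases hj.eq_or_lt with rfl | hj
  · have : P.coeff Z.card = 1 := by rw [← hdeg]; exact hmonic
    rw [this, mul_one, sub_self]
  · rw [Polynomial.coeff_eq_zero_of_natDegree_lt (hp.trans_lt hj),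
      Polynomial.coeff_eq_zero_of_natDegree_lt (hdeg.trans_lt hj), mul_zero, sub_zero]

/-- Extrapolation of a polynomial of degree at most `d` from the nodes `0, τ, …, d τ` to `1`. -/
lemma pow_mul_eval_one_eq_sum {F R : Type*} [Field F] [CharZero F] [CommRing R] [IsDomain R]
    [Algebra F R] {τ : R} (hτ : τ ≠ 0) {d : ℕ} {P : Polynomial R} (hP : P.natDegree ≤ d) :
    τ ^ d * P.eval 1 = ∑ i ∈ Finset.range (d + 1),
      algebraMap F R (∏ j ∈ (Finset.range (d + 1)).erase i, ((i : F) - j)⁻¹) *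
        (∏ j ∈ (Finset.range (d + 1)).erase i, (1 - (j : R) * τ)) * P.eval ((i : R) * τ) := by
  -- Lagrange's formula holds over `K`, where its denominators are products of `(i - j) τ`; the
  -- factor `τ ^ d` cancels the powers of `τ`, and the integers are invertible in `F`.
  let K := FractionRing R
  have hinj : Function.Injective (algebraMap R K) := IsFractionRing.injective R K
  have hchar : CharZero R := charZero_of_injective_algebraMap (algebraMap F R).injective
  have hcharK : CharZero K := charZero_of_injective_algebraMap hinj
  set t := algebraMap R K τ with ht
  have ht0 : t ≠ 0 := by simpa [ht] using hτ
  have hv : Set.InjOn (fun i : ℕ => (i : K) * t) (Finset.range (d + 1)) := fun i _ j _ hij => by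
    simpa [ht0] using hij
  have hdeg : (P.map (algebraMap R K)).degree < (Finset.range (d + 1)).card := by
    rw [Finset.card_range]
    exact (Polynomial.degree_map_le.trans Polynomial.degree_le_natDegree).trans_lt
      (by exact_mod_cast Nat.lt_succ_of_le hP)
  have key := congrArg (Polynomial.eval 1) (Lagrange.eq_interpolate hv hdeg)
  rw [Lagrange.interpolate_apply, Polynomial.eval_finsetSum] at key
  apply hinj
  rw [map_mul, map_pow, map_sum, ← ht]
  have e1 : algebraMap R K (P.eval 1) = (P.map (algebraMap R K)).eval 1 := by
    rw [← Polynomial.eval₂_eq_eval_map, Polynomial.eval₂_at_one]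
  rw [e1, key, Finset.mul_sum]
  refine Finset.sum_congr rfl fun i hi => ?_
  have e2 : algebraMap R K (P.eval ((i : R) * τ)) =
      (P.map (algebraMap R K)).eval ((i : K) * t) := by
    rw [← Polynomial.eval₂_eq_eval_map, show (i : K) * t = algebraMap R K (i * τ) by simp [ht],
      Polynomial.eval₂_at_apply]
  have hcard : ((Finset.range (d + 1)).erase i).card = d := by
    rw [Finset.card_erase_of_mem hi]; simp
  rw [map_mul, map_mul, e2, Polynomial.eval_mul, Polynomial.eval_C, Lagrange.basis,
    Polynomial.eval_prod, map_prod, map_prod, map_prod]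
  nth_rewrite 1 [← hcard]
  rw [mul_left_comm, ← Finset.prod_const, ← Finset.prod_mul_distrib, ← Finset.prod_mul_distrib,
    mul_comm]
  congr 1
  refine Finset.prod_congr rfl fun j hj => ?_
  have hij : (i : K) - j ≠ 0 :=
    sub_ne_zero.2 (Nat.cast_injective.ne (Finset.ne_of_mem_erase hj).symm)
  rw [← IsScalarTower.algebraMap_apply F R K]
  simp only [Lagrange.basisDivisor, Polynomial.eval_mul, Polynomial.eval_C, Polynomial.eval_sub,
    Polynomial.eval_X, map_sub, map_one, map_mul, map_natCast, map_inv₀, ← ht]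
  rw [← sub_mul, mul_inv, mul_comm (_)⁻¹ t⁻¹, mul_assoc, mul_inv_cancel_left₀ ht0]

end Interpolation

/-! ### From roots to the factor -/

section Assembly

variable {F : Type u} [Field F] {n : ℕ}

/-- The cost of computing modulo `x_i ^ N` a factor of degree `d` of a polynomial with a circuit of
size `s`. -/
def quotientCost {A : Type*} [CommSemiring A] (s d N : A) : A :=
  8 * N + 12 + 6 * d + (d + 1) * (38 + 36 * d + d * (16 + d * (106 * s + 34)))

lemma quotientCost_mono {s s' d d' N N' : ℕ} (hs : s ≤ s') (hd : d ≤ d') (hN : N ≤ N') :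
    quotientCost s d N ≤ quotientCost s' d' N' := by
  unfold quotientCost
  gcongr

lemma aeval_X_eq_coe (p : MvPolynomial (Fin n) F) :
    aeval (MvPowerSeries.X : Fin n → MvPowerSeries (Fin n) F) p = (p : MvPowerSeries (Fin n) F) := by
  induction p using MvPolynomial.induction_on with
  | C c => rw [aeval_C_eq_C, MvPolynomial.coe_C]
  | add p q hp hq => rw [map_add, hp, hq, MvPolynomial.coe_add]
  | mul_X p i hp => rw [map_mul, hp, aeval_X, MvPolynomial.coe_mul, MvPolynomial.coe_X]

/-- Approximate roots on a line give the value of the polynomial at its base point. -/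
lemma pow_dvd_aeval_sub_prod {h : MvPolynomial (Fin n) F} {τ : MvPowerSeries (Fin n) F} {k : ℕ}
    (w : Fin n → MvPowerSeries (Fin n) F) (a : Fin n → F) {Z : Finset F}
    (hZ : Z.card = h.totalDegree) (φ : F → MvPowerSeries (Fin n) F)
    (hφ : ∀ ρ ∈ Z, MvPowerSeries.constantCoeff (φ ρ) = ρ)
    (hroot : ∀ ρ ∈ Z, τ ^ k ∣ (onLine w a h).eval (φ ρ)) :
    τ ^ k ∣ aeval w h - algebraMap F (MvPowerSeries (Fin n) F)
      (eval a (homogeneousComponent h.totalDegree h)) * ∏ ρ ∈ Z, -φ ρ := by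
  -- Modulo `τ ^ k` the approximate roots are exact, and their differences remain units because the
  -- constant terms `ρ` are distinct. The resulting factorization is then evaluated at `y = 0`.
  set I := Ideal.span {τ ^ k}
  have key := eq_C_mul_prod_X_sub_C (p := (onLine w a h).map (Ideal.Quotient.mk I)) (Z := Z)
    (Polynomial.natDegree_map_le.trans ((natDegree_onLine_le w a h).trans hZ.ge))
    (fun ρ => Ideal.Quotient.mk I (φ ρ))
    (fun ρ hρ => by
      rw [Polynomial.eval_map_apply, Ideal.Quotient.eq_zero_iff_dvd]
      exact hroot ρ hρ)
    (fun ρ hρ σ hσ hne => by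
      rw [← map_sub]
      refine IsUnit.map _ ?_
      rw [MvPowerSeries.isUnit_iff_constantCoeff, map_sub, hφ ρ hρ, hφ σ hσ]
      exact (sub_ne_zero.2 hne).isUnit)
  have key := congrArg (Polynomial.eval (Ideal.Quotient.mk I 0)) key
  rw [Polynomial.eval_map_apply, Polynomial.eval_mul, Polynomial.eval_C, Polynomial.coeff_map, hZ,
    coeff_onLine_totalDegree, Polynomial.eval_prod, eval_onLine] at key
  simp only [mul_zero, add_zero, Polynomial.eval_sub, Polynomial.eval_X, Polynomial.eval_C,
    ← map_sub, ← map_prod, ← map_mul, zero_sub] at key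
  rwa [Ideal.Quotient.eq, Ideal.mem_span_singleton] at key

lemma Computes.natCast {T : Set (MvPowerSeries (Fin n) F)} (k : ℕ) :
    Computes T 2 {(k : MvPowerSeries (Fin n) F)} := by
  have := Computes.algebraMap (T := T) (n := n) (k : F)
  rwa [map_natCast] at this

/-- A prime factor `h` of a polynomial with a small circuit is congruent modulo `x_{i₀} ^ N` to a
quotient of polynomials with small circuits. -/
lemma exists_quotient_of_prime [IsAlgClosed F] [CharZero F] {s : ℕ} {f h : MvPolynomial (Fin n) F}
    (hf : f ≠ 0) (hs : HasCircuitOfSize s f) (hh : Prime h) (hd : h.totalDegree ≠ 0) (hdvd : h ∣ f)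
    (i₀ : Fin n) {N : ℕ} (hN : N ≠ 0) :
    ∃ q : MvPowerSeries (Fin n) F,
      (MvPowerSeries.X i₀ : MvPowerSeries (Fin n) F) ^ N ∣ q - (h : MvPowerSeries (Fin n) F) ∧
      Computes ∅ (quotientCost s h.totalDegree N) {q} := by
  classical
  have hfin := FiniteMultiplicity.of_prime_left hh hf
  obtain ⟨g, hfg, hg⟩ := hfin.exists_eq_pow_mul_and_not_dvd
  have he : multiplicity h f ≠ 0 := multiplicity_ne_zero.2 hdvd
  obtain ⟨a, b, Z, hZ, ha, hZ'⟩ := exists_line_roots hh hd hg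
  set d := h.totalDegree with hd_def
  set τ := (MvPowerSeries.X i₀ : MvPowerSeries (Fin n) F) ^ N with hτ_def
  have hτ0 : MvPowerSeries.constantCoeff τ = 0 := by simp [hτ_def, hN]
  have hτ : τ ≠ 0 := pow_ne_zero _ fun h0 => by
    have := congrArg (MvPowerSeries.coeff (Finsupp.single i₀ 1)) h0
    simp [MvPowerSeries.coeff_X] at this
  have hτm : τ ∈ ({τ} : Set (MvPowerSeries (Fin n) F)) := rfl
  have : IsDomain (MvPowerSeries (Fin n) F) := NoZeroDivisors.to_isDomain _
  let β : Fin n → MvPowerSeries (Fin n) F := fun j => algebraMap F _ (b j)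
  -- The point of the segment from `b` to `x` at parameter `i τ`; it is `≡ b` modulo `τ`, as lifting
  -- the roots requires.
  let w : ℕ → Fin n → MvPowerSeries (Fin n) F := fun i j =>
    β j + (MvPowerSeries.X j - β j) * ((i : MvPowerSeries (Fin n) F) * τ)
  have hw : ∀ i j, Computes {τ} 52 {w i j} := fun i j =>
    ((Computes.algebraMap (b j)).add (((Computes.X j).sub (Computes.algebraMap (b j))).mul
      ((Computes.natCast i).mul (.of_mem hτm)))).mono_cost (by omega)
  have hwb : ∀ i j, τ ∣ w i j - algebraMap F _ (b j) := fun i j =>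
    ⟨(MvPowerSeries.X j - β j) * (i : MvPowerSeries (Fin n) F), by simp only [w, β]; ring⟩
  have hroots : ∀ (i : ℕ) (ρ : F), ∃ φ : MvPowerSeries (Fin n) F, ρ ∈ Z →
      MvPowerSeries.constantCoeff φ = ρ ∧ τ ^ (d + 1) ∣ (onLine (w i) a h).eval φ ∧
      Computes {τ} (2 + d * (s * (52 + 54) + 34)) {φ} := fun i ρ => by
    by_cases hρ : ρ ∈ Z
    · obtain ⟨h0, h1, h2⟩ := hZ' ρ hρ
      obtain ⟨φ, hφ⟩ := exists_approx_root he hfg hs hτ0 (hw i) a b (hwb i) h0 h1 h2 d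
      exact ⟨φ, fun _ => hφ⟩
    · exact ⟨0, fun h => absurd h hρ⟩
  choose φ hφ using hroots
  let c := eval a (homogeneousComponent d h)
  let v : ℕ → MvPowerSeries (Fin n) F := fun i => algebraMap F _ c * ∏ ρ ∈ Z, -φ i ρ
  have hv : ∀ i, τ ^ (d + 1) ∣ aeval (w i) h - v i := fun i =>
    pow_dvd_aeval_sub_prod (w i) a hZ (φ i) (fun ρ hρ => (hφ i ρ hρ).1)
      fun ρ hρ => (hφ i ρ hρ).2.1
  have hvc : ∀ i, Computes {τ} (10 + d * (16 + d * (106 * s + 34))) {v i} := fun i => by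
    refine ((Computes.algebraMap c).mul (Computes.prod Z _ fun ρ hρ =>
      ((hφ i ρ hρ).2.2.neg))).mono_cost (le_of_eq ?_)
    rw [hZ]
    ring
  let l : ℕ → MvPowerSeries (Fin n) F := fun i =>
    algebraMap F _ (∏ j ∈ (Finset.range (d + 1)).erase i, ((i : F) - j)⁻¹) *
        (∏ j ∈ (Finset.range (d + 1)).erase i, (1 - (j : MvPowerSeries (Fin n) F) * τ))
  have hl : ∀ i ∈ Finset.range (d + 1), Computes {τ} (10 + d * 36) {l i} := fun i hi => by
    have hcard : ((Finset.range (d + 1)).erase i).card = d := by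
      rw [Finset.card_erase_of_mem hi]; simp
    have h1 : Computes {τ} 2 {(1 : MvPowerSeries (Fin n) F)} := by
      simpa using Computes.natCast (T := {τ}) (n := n) (F := F) 1
    refine ((Computes.algebraMap _).mul (Computes.prod _ _ fun j _ =>
      h1.sub ((Computes.natCast j).mul (.of_mem hτm)))).mono_cost (le_of_eq ?_)
    rw [hcard]
    ring
  let P : Polynomial (MvPowerSeries (Fin n) F) := aeval (fun j => Polynomial.C (β j) +
    Polynomial.C (MvPowerSeries.X j - β j) * Polynomial.X) h
  have hPeval : ∀ t, P.eval t = aeval (fun j => β j + (MvPowerSeries.X j - β j) * t) h :=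
    fun t => by
      have := MvPolynomial.map_aeval (fun j => Polynomial.C (β j) +
        Polynomial.C (MvPowerSeries.X j - β j) * Polynomial.X) (Polynomial.evalRingHom t) h
      simp only [Polynomial.coe_evalRingHom] at this
      rw [show P.eval t = _ from this, aeval_def, MvPolynomial.coe_eval₂Hom]
      congr 1
      · ext c
        simp [Polynomial.algebraMap_apply]
      · ext j
        simp
  have hPdeg : P.natDegree ≤ d := by
    have h1 : P = aeval (fun j => Polynomial.C (β j) +
        Polynomial.C (MvPowerSeries.X j - β j) * Polynomial.X)
        (map (algebraMap F (MvPowerSeries (Fin n) F)) h) := by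
      rw [MvPolynomial.aeval_map_algebraMap]
    rw [h1, ← mul_one d]
    exact MvPolynomial.aeval_natDegree_le _ (Finset.sup_mono (support_map_subset _ _)) _ fun j => by compute_degree
  have hsum := pow_mul_eval_one_eq_sum (F := F) hτ hPdeg
  have hP1 : P.eval 1 = (h : MvPowerSeries (Fin n) F) := by
    rw [hPeval, ← aeval_X_eq_coe]
    congr 2
    ext1 j
    ring
  have hdiff : τ ^ (d + 1) ∣ τ ^ d * (h : MvPowerSeries (Fin n) F) -
      ∑ i ∈ Finset.range (d + 1), l i * v i := by
    rw [← hP1, hsum, ← Finset.sum_sub_distrib]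
    refine Finset.dvd_sum fun i _ => ?_
    rw [hPeval, ← mul_sub]
    exact (hv i).mul_left _
  obtain ⟨r, hr⟩ := hdiff
  -- This is the interpolation sum divided by `τ ^ d`: by `hr` the sum equals `τ ^ d * (h - τ * r)`.
  refine ⟨(h : MvPowerSeries (Fin n) F) - τ * r, ⟨-r, by ring⟩, ?_⟩
  have hτc : Computes (∅ : Set (MvPowerSeries (Fin n) F)) (2 + N * 8) {τ} :=
    (Computes.X i₀).pow N
  have hqc := (Computes.sum (T := {τ}) (Finset.range (d + 1)) (fun i => l i * v i)
    fun i hi => (hl i hi).mul (hvc i)).div ((Computes.of_mem hτm).pow d) (pow_ne_zero d hτ)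
    (q := (h : MvPowerSeries (Fin n) F) - τ * r) (by linear_combination hr)
  refine (hτc.trans_right (hqc.mono_left (by simp))).mono_cost (le_of_eq ?_)
  rw [Finset.card_range, quotientCost]
  ring

/-- A factor `h` of a polynomial with a small circuit is congruent modulo `x_{i₀} ^ N` to a
quotient of polynomials with small circuits. -/
lemma exists_quotient_of_dvd [IsAlgClosed F] [CharZero F] {s D : ℕ} {f : MvPolynomial (Fin n) F}
    (hf : f ≠ 0) (hs : HasCircuitOfSize s f) (i₀ : Fin n) {N : ℕ} (hN : N ≠ 0)
    (h : MvPolynomial (Fin n) F) (hdvd : h ∣ f) (hD : h.totalDegree ≤ D) :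
    ∃ q : MvPowerSeries (Fin n) F,
      (MvPowerSeries.X i₀ : MvPowerSeries (Fin n) F) ^ N ∣ q - (h : MvPowerSeries (Fin n) F) ∧
      Computes ∅ (2 + h.totalDegree * (quotientCost s D N + 6)) {q} := by
  -- The bound `D` stays fixed, so every prime factor is charged the same amount.
  induction h using UniqueFactorizationMonoid.induction_on_prime with
  | h₁ => exact absurd (zero_dvd_iff.1 hdvd) hf
  | h₂ h hu =>
    obtain ⟨c, -, rfl⟩ := MvPolynomial.isUnit_iff_eq_C_of_isReduced.1 hu
    refine ⟨MvPowerSeries.C c, by simp, (Computes.const c).mono_cost (by omega)⟩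
  | h₃ a p ha hp ih =>
    have hpd : p.totalDegree ≠ 0 := fun h0 => by
      rw [totalDegree_eq_zero_iff_eq_C] at h0
      refine hp.not_isUnit ?_
      rw [h0]
      refine (isUnit_iff_ne_zero.2 fun h1 => hp.ne_zero ?_).map C
      rw [h0, h1, C_0]
    have hdeg := totalDegree_mul_of_isDomain hp.ne_zero ha
    obtain ⟨q₁, hq₁, hc₁⟩ := ih ((dvd_mul_left a p).trans hdvd) (by omega)
    obtain ⟨q₂, hq₂, hc₂⟩ := exists_quotient_of_prime hf hs hp hpd
      ((dvd_mul_right p a).trans hdvd) i₀ hN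
    refine ⟨q₂ * q₁, ?_, (hc₂.mul hc₁).mono_cost ?_⟩
    · rw [MvPolynomial.coe_mul, show q₂ * q₁ - (p : MvPowerSeries (Fin n) F) * a =
        (q₂ - p) * q₁ + p * (q₁ - a) by ring]
      exact dvd_add (hq₂.mul_right _) (hq₁.mul_left _)
    · have h1 : quotientCost s p.totalDegree N ≤ quotientCost s D N :=
        quotientCost_mono le_rfl (by omega) le_rfl
      -- A prime has degree at least one, so the degree of `h` bounds the number of its prime
      -- factors.
      have h2 : 1 * (quotientCost s D N + 6) ≤ p.totalDegree * (quotientCost s D N + 6) :=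
        Nat.mul_le_mul_right _ (by omega)
      rw [hdeg, add_mul]
      omega

lemma HasCircuitOfSize.pos {s : ℕ} {f : MvPolynomial (Fin n) F} (h : HasCircuitOfSize s f) :
    0 < s := by
  obtain ⟨k, c, i, -, hs⟩ := h
  cases c with
  | nil => exact i.elim0
  | snoc c g => rw [AlgCircuit.size] at hs; omega

lemma HasCircuitOfSize.mono {s t : ℕ} {f : MvPolynomial (Fin n) F} (h : HasCircuitOfSize s f)
    (hst : s ≤ t) : HasCircuitOfSize t f := by
  obtain ⟨k, c, i, hf, hs⟩ := h
  exact ⟨k, c, i, hf, hs.trans hst⟩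

end Assembly

theorem theorem2 :
    ∃ p : Polynomial ℕ,
      ∀ (F : Type u) [Field F] [IsAlgClosed F] [CharZero F] (n s d : ℕ)
        (f h : MvPolynomial (Fin n) F),
        f ≠ 0 → HasCircuitOfSize s f → h ∣ f → h.totalDegree = d →
          ∃ A B : MvPolynomial (Fin n) F,
            HasCircuitOfSize (p.eval (s * d)) A ∧
            HasCircuitOfSize (p.eval (s * d)) B ∧
            IsQuotientMod h A B (d + 1) := by
  -- The cost formula, read in `ℕ[X]` with `s` and `d` both replaced by `X`, which stands for `s *
  -- d`.
  refine ⟨2 + Polynomial.X * (quotientCost Polynomial.X Polynomial.X (Polynomial.X + 1) + 6), ?_⟩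
  intro F _ _ _ n s d f h hf hs hdvd hd
  have heval : ∀ M : ℕ, (2 + Polynomial.X * (quotientCost Polynomial.X Polynomial.X
      (Polynomial.X + 1) + 6) : Polynomial ℕ).eval M = 2 + M * (quotientCost M M (M + 1) + 6) :=
    fun M => by simp [quotientCost]
  suffices hq : ∃ q : MvPowerSeries (Fin n) F,
      q - (h : MvPowerSeries (Fin n) F) ∈ varIdeal F n ^ (d + 1) ∧
      Computes ∅ (2 + d * (quotientCost s d (d + 1) + 6)) {q} by
    obtain ⟨q, hq, hc⟩ := hq
    obtain ⟨A, B, hA, hB, hB0, hAB⟩ := hc.exists_hasCircuitOfSize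
    have hle : 2 + d * (quotientCost s d (d + 1) + 6) ≤
        2 + s * d * (quotientCost (s * d) (s * d) (s * d + 1) + 6) := by
      -- For `d = 0` the product `s * d` does not bound `s`, but the cost is then the constant 2.
      rcases Nat.eq_zero_or_pos d with rfl | hd0
      · simp
      · have h1 : s ≤ s * d := Nat.le_mul_of_pos_right s hd0
        have h2 : d ≤ s * d := Nat.le_mul_of_pos_left d hs.pos
        have h3 := quotientCost_mono h1 h2 (Nat.add_le_add_right h2 1)
        gcongr
    rw [heval]
    exact ⟨A, B, hA.mono hle, hB.mono hle, hB0, q, hAB, hq⟩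
  rcases Nat.eq_zero_or_pos d with rfl | hd0
  · rw [totalDegree_eq_zero_iff_eq_C] at hd
    refine ⟨MvPowerSeries.C (coeff 0 h), ?_, (Computes.const _).mono_cost (by omega)⟩
    rw [hd, MvPolynomial.coe_C, coeff_C, if_pos rfl, sub_self]
    exact zero_mem _
  · obtain ⟨i₀⟩ : Nonempty (Fin n) := by
      by_contra hn
      rw [not_nonempty_iff] at hn
      rw [MvPolynomial.eq_C_of_isEmpty h, totalDegree_C] at hd
      omega
    obtain ⟨q, hq, hc⟩ := exists_quotient_of_dvd (N := d + 1) hf hs i₀ (by omega) h hdvd hd.le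
    rw [hd] at hc
    exact ⟨q, Ideal.mem_of_dvd _ hq (Ideal.pow_mem_pow (Ideal.subset_span (Set.mem_range_self i₀)) _), hc⟩
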